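/- **Theorem 5 (Handling any value of $k$, UXS version).** *Model.* An $n$-node capacitated graph is a connected simple undirected graph with $n$ anonymous nodes and $m$ edges, in which the edges at each node $v$ carry the local port numbers $0,\dots,\deg(v)-1$, together with a capacity $c(v)\in\{0,1,2,\dots\}$ for each node. There are $k>1$ robots with distinct integer IDs in $[1,k^q]$, placed on arbitrary nodes; one of them is the shepherd, which the others recognize when co-located. We have $c(v)\le k^p$ for all $v$ and $\sum_v c(v)\ge k$, where $p,q>0$ are constants. Time proceeds in synchronous rounds: in each round the robots at a common node exchange messages, each robot computes (deterministically, from its memory, the degree and capacity of its node, the port by which it has just entered, and the messages) its new memory content and its action, and then it stays, leaves through a port, or terminates at its node. A robot's memory is the bit string it keeps from one round to the next. The initial memory of the shepherd may depend only on its ID and on $n$, that of any other robot only on its ID; so only the shepherd knows $n$ and no robot knows $k$. The robots *solve dispersion in time $T$* if after at most $T$ rounds all robots have terminated and every node $v$ holds at most $c(v)$ robots. *Universal exploration sequences.* Let $\mathcal G$ be a class of port-labelled graphs (for instance all of them). A UXS procedure for $\mathcal G$ with running time $X$ and memory $M_x$ takes $N$ as input and generates integers $x_1,x_2,\dots$ one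 after the other, holding at most $M_x=M_x(N)$ bits of memory during its $X(N)$ rounds (besides $N$), such that in every connected graph of $\mathcal G$ with at most $N$ nodes, from every start node, the following walk visits all nodes within $X(N)$ rounds: first leave through port $0$; in step $i\ge 1$, if the current node $u$ was entered through port $p_i$, leave it through port $(p_i+x_i)\bmod \deg(u)$. *Claim.* For every class $\mathcal G$ and every UXS procedure for $\mathcal G$ with running time $X$ and memory $M_x$ there is a deterministic algorithm (not depending on $p,q,k$ or the graph) by which $k$ robots, for any $k>1$, initially arbitrarily located on any $n$-node capacitated graph with $m$ edges whose underlying port-labelled graph belongs to $\mathcal G$, solve dispersion in time $O(X(n)+n^3+m)$, where the shepherd uses $O(M_x(n)+m\log(nk))$ bits of memory and each other robot uses $O(\log k)$ bits of memory. The constants in the $O(\cdot)$ depend only on $p$ and $q$. -/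

import Mathlib

/-- An anonymous port-labelled graph on `n` nodes: a simple undirected graph in which, at every
node `v`, the incident edges carry the local port numbers `0, …, deg v - 1`. The numbers at the
two ends of an edge are unrelated. Robots never see the names of the nodes. -/
structure PortGraph (n : ℕ) where
  graph : SimpleGraph (Fin n)
  port : ∀ v : Fin n, Fin (Nat.card (graph.neighborSet v)) ≃ graph.neighborSet v

namespace PortGraph

variable {n : ℕ}

/-- Degree of a node. -/
noncomputable def deg (G : PortGraph n) (v : Fin n) : ℕ := Nat.card (G.graph.neighborSet v)

/-- Number of edges. -/
noncomputable def numEdges (G : PortGraph n) : ℕ := G.graph.edgeSet.ncard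

/-- Leaving `v` through port `i`: the node reached, with the port number by which it is entered;
`none` if `v` has no port `i`. -/
noncomputable def traverse (G : PortGraph n) (v : Fin n) (i : ℕ) : Option (Fin n × ℕ) :=
  if h : i < Nat.card (G.graph.neighborSet v) then
    some (((G.port v ⟨i, h⟩ : G.graph.neighborSet v) : Fin n),
      ((G.port (G.port v ⟨i, h⟩ : G.graph.neighborSet v)).symm
        ⟨v, (G.port v ⟨i, h⟩).2.symm⟩ : ℕ))
  else none

end PortGraph

/-- A procedure that, on input `N`, generates the integer sequence `x₁, x₂, …` of an exploration
walk one term after the other. Between two terms it keeps only a string of bits of memory (the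
input `N` itself is always available to it). -/
structure ExplorationProcedure where
  initMem : ℕ → List Bool
  nextMem : ℕ → List Bool → List Bool
  out : ℕ → List Bool → ℤ

namespace ExplorationProcedure

/-- Memory content from which the term `x_{i+1}` is produced. -/
def mem (U : ExplorationProcedure) (N i : ℕ) : List Bool := (U.nextMem N)^[i] (U.initMem N)

/-- The generated sequence: `U.seq N i` is the term `x_{i+1}`. -/
def seq (U : ExplorationProcedure) (N i : ℕ) : ℤ := U.out N (U.mem N i)

/-- The walk along the sequence for input `N`, from `s`: node after `t` rounds, and the port by
which it was entered. The first move is through port `0`; in step `i ≥ 1` a node of degree `δ`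
that was entered through port `p` is left through port `(p + x_i) mod δ`. (On the one-node graph
there is no port and the walk stays.) -/
noncomputable def walk (U : ExplorationProcedure) {n : ℕ} (G : PortGraph n) (N : ℕ) (s : Fin n) :
    ℕ → Fin n × ℕ
  | 0 => (s, 0)
  | 1 => (G.traverse s 0).getD (s, 0)
  | t + 2 =>
    let w := walk U G N s (t + 1)
    (G.traverse w.1 (((w.2 : ℤ) + U.seq N t) % (G.deg w.1 : ℤ)).toNat).getD w

/-- `U` is a universal exploration sequence procedure with running time `X` on the connected
graphs of the class `𝒢` (for instance the class of all graphs): with input `N`, from every start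
in every connected graph of the class with at most `N` nodes, the walk visits all nodes within
`X N` rounds. -/
def IsUXS (U : ExplorationProcedure) (𝒢 : ∀ n : ℕ, PortGraph n → Prop) (X : ℕ → ℕ) : Prop :=
  ∀ (N n : ℕ), n ≤ N → ∀ G : PortGraph n, 𝒢 n G → G.graph.Connected →
    ∀ s v : Fin n, ∃ t ≤ X N, (U.walk G N s t).1 = v

/-- With input `N`, the procedure uses at most `M N` bits of memory during its `X N` rounds. -/
def UsesMemory (U : ExplorationProcedure) (X M : ℕ → ℕ) : Prop :=
  ∀ N i : ℕ, i < X N → (U.mem N i).length ≤ M N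

end ExplorationProcedure

/-- What a robot perceives by itself in a round: the degree and the capacity of its current node,
and, only in the round right after a move, the port by which it entered the node. -/
structure LocalView where
  deg : ℕ
  cap : ℕ
  entry : Option ℕ

/-- What a robot does at the end of a round: stay, leave through a port, or stay and terminate. -/
inductive RobotAction where
  | stay
  | move (i : ℕ)
  | terminate

/-- A deterministic algorithm for one shepherd and any number of other robots. What a robot keeps
from one round to the next is a string of bits. The initial content of the shepherd's memory may
depend on the number of nodes and on its ID, that of any other robot on its ID only. In each round
the robots at a node first tell each other a message, which may depend on the memory and on the
local view of the sender; then each robot computes its new memory content and its action from its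
memory, its local view and the messages it hears. A robot recognizes the message of the
shepherd. -/
structure RobotAlgorithm where
  Msg : Type
  shepherdInit : (numNodes : ℕ) → (ID : ℕ) → List Bool
  robotInit : (ID : ℕ) → List Bool
  shepherdSay : List Bool → LocalView → Msg
  robotSay : List Bool → LocalView → Msg
  /-- The last argument holds the messages of the other robots at the node. -/
  shepherdStep : List Bool → LocalView → Multiset Msg → List Bool × RobotAction
  /-- The last arguments are the message of the shepherd, if it is at the node, and the messages
  of the other non-shepherd robots at the node. -/
  robotStep : List Bool → LocalView → Option Msg → Multiset Msg → List Bool × RobotAction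

/-- `k` robots, one of them the shepherd, placed on a capacitated graph with `n` nodes. -/
structure Scenario (n k : ℕ) where
  G : PortGraph n
  cap : Fin n → ℕ
  shepherd : Fin k
  ID : Fin k → ℕ
  start : Fin k → Fin n

/-- The standing assumptions of the model: the graph is connected, there is more than one robot,
the capacities lie in `[0, k ^ p]` and add up to at least `k`, and the robots have distinct IDs in
`[1, k ^ q]`. The starting positions are arbitrary. -/
structure Scenario.Valid {n k : ℕ} (S : Scenario n k) (p q : ℝ) : Prop where
  connected : S.G.graph.Connected
  one_lt : 1 < k
  cap_le : ∀ v, (S.cap v : ℝ) ≤ (k : ℝ) ^ p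
  le_sum_cap : k ≤ ∑ v, S.cap v
  ID_injective : Function.Injective S.ID
  one_le_ID : ∀ r, 1 ≤ S.ID r
  ID_le : ∀ r, (S.ID r : ℝ) ≤ (k : ℝ) ^ q

/-- The state of one robot between two rounds. -/
structure RobotState (n : ℕ) where
  pos : Fin n
  mem : List Bool
  entry : Option ℕ
  terminated : Bool

namespace RobotAlgorithm

variable {n k : ℕ}

noncomputable def view (S : Scenario n k) (ρ : RobotState n) : LocalView :=
  ⟨S.G.deg ρ.pos, S.cap ρ.pos, ρ.entry⟩

/-- The message told by robot `r` in the current round. -/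
noncomputable def say (A : RobotAlgorithm) (S : Scenario n k) (σ : Fin k → RobotState n)
    (r : Fin k) : A.Msg :=
  if r = S.shepherd then A.shepherdSay (σ r).mem (view S (σ r))
  else A.robotSay (σ r).mem (view S (σ r))

/-- Robot `r` hears robot `r'`: they are different, at the same node, and `r'` has not terminated
(a robot that has terminated is silent). -/
def Hears (σ : Fin k → RobotState n) (r r' : Fin k) : Prop :=
  r' ≠ r ∧ (σ r').pos = (σ r).pos ∧ (σ r').terminated = false

instance (σ : Fin k → RobotState n) (r r' : Fin k) : Decidable (Hears σ r r') := by
  unfold Hears; infer_instance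

/-- Messages of the non-shepherd robots that `r` hears. -/
noncomputable def heard (A : RobotAlgorithm) (S : Scenario n k) (σ : Fin k → RobotState n)
    (r : Fin k) : Multiset A.Msg :=
  (Finset.univ.filter fun r' => r' ≠ S.shepherd ∧ Hears σ r r').val.map (A.say S σ)

/-- Message of the shepherd, if `r` hears it. -/
noncomputable def heardShepherd (A : RobotAlgorithm) (S : Scenario n k) (σ : Fin k → RobotState n)
    (r : Fin k) : Option A.Msg :=
  if Hears σ r S.shepherd then some (A.say S σ S.shepherd) else none

/-- The local computation of robot `r` in the current round. -/
noncomputable def compute (A : RobotAlgorithm) (S : Scenario n k) (σ : Fin k → RobotState n)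
    (r : Fin k) : List Bool × RobotAction :=
  if r = S.shepherd then A.shepherdStep (σ r).mem (view S (σ r)) (A.heard S σ r)
  else A.robotStep (σ r).mem (view S (σ r)) (A.heardShepherd S σ r) (A.heard S σ r)

/-- The state of a robot after storing `mem` and performing an action. Trying to leave through a
port that does not exist amounts to staying. -/
noncomputable def act (S : Scenario n k) (ρ : RobotState n) (mem : List Bool) :
    RobotAction → RobotState n
  | .stay => ⟨ρ.pos, mem, none, false⟩
  | .terminate => ⟨ρ.pos, mem, none, true⟩
  | .move i =>
    match S.G.traverse ρ.pos i with
    | some (w, j) => ⟨w, mem, some j, false⟩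
    | none => ⟨ρ.pos, mem, none, false⟩

/-- One synchronous round. Robots that have terminated do nothing. -/
noncomputable def round (A : RobotAlgorithm) (S : Scenario n k) (σ : Fin k → RobotState n) :
    Fin k → RobotState n := fun r =>
  if (σ r).terminated then σ r
  else act S (σ r) (A.compute S σ r).1 (A.compute S σ r).2

/-- The states of all robots after `t` rounds. -/
noncomputable def run (A : RobotAlgorithm) (S : Scenario n k) : ℕ → Fin k → RobotState n
  | 0 => fun r =>
    ⟨S.start r, if r = S.shepherd then A.shepherdInit n (S.ID r) else A.robotInit (S.ID r),
      none, false⟩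
  | t + 1 => A.round S (A.run S t)

/-- After `t` rounds all robots have terminated, and each node holds at most as many robots as its
capacity allows. -/
def DispersedAt (A : RobotAlgorithm) (S : Scenario n k) (t : ℕ) : Prop :=
  (∀ r, (A.run S t r).terminated = true) ∧
    ∀ v, (Finset.univ.filter fun r => (A.run S t r).pos = v).card ≤ S.cap v

/-- Bits of memory held by robot `r` after `t` rounds. -/
noncomputable def memBits (A : RobotAlgorithm) (S : Scenario n k) (r : Fin k) (t : ℕ) : ℕ :=
  (A.run S t r).mem.length

end RobotAlgorithm

/-! The walk of the shepherd is reversible: an entry port and the following exit port differ by a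
known term of the sequence, modulo the degree (`backwardPort_exitPort`). So the shepherd can patrol
a covering walk forth and back twice, keeping only `n`, a clock and one index; the terms are
recomputed from the clock, and the other robots keep nothing but their IDs.

On the first way every robot that is met joins the shepherd, so all end up at the last node
(`run_gather`). On the way back, the robots with the smallest IDs stay at each node up to its
capacity and the rest move on. Either nobody is left over at some point, or all nodes left behind
are full (`Settling.round`). Since `k - 1` robots cannot fill a total capacity of at least `k`, all
of them find room and one place remains, noticed by the shepherd as its refuge (`run_settle`). The
third way tells everyone to terminate, the fourth leads to the refuge (`dispersed`).

A clock running up to `X n` may need too many bits. But the walk is driven by its node, its entry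
port and `M n` bits, so it becomes periodic after `n ^ 2 * 2 ^ (M n + 1)` steps at the latest and
discovers nothing new from then on (`exists_le_cutoff`). Truncated there, it needs a clock of only
`O(M n + log n)` bits. -/

/-! ### Coding of numbers by bit strings -/

/-- The number with the binary digits `l`, least significant digit first. -/
def natOfBits (l : List Bool) : ℕ := l.foldr Nat.bit 0

theorem natOfBits_bits (a : ℕ) : natOfBits a.bits = a := by
  induction a using Nat.binaryRec' with
  | zero => rfl
  | bit b a h ih =>
    rw [Nat.bits_append_bit a b h]
    simp only [natOfBits, List.foldr_cons] at ih ⊢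
    rw [ih]

/-- Bit strings as positive numbers: the digits of `l`, headed by a digit `1`. -/
def bitStringCode (l : List Bool) : ℕ := l.foldr Nat.bit 1

theorem bitStringCode_pos (l : List Bool) : 0 < bitStringCode l := by
  induction l with
  | nil => simp [bitStringCode]
  | cons b l ih =>
    have : bitStringCode (b :: l) = Nat.bit b (bitStringCode l) := rfl
    rw [this, Nat.bit_val]
    omega

/-- With injectivity, this counts the strings of at most `M` bits, of all lengths together: fewer
than `2 ^ (M + 1)`. -/
theorem bitStringCode_lt (l : List Bool) : bitStringCode l < 2 ^ (l.length + 1) := by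
  induction l with
  | nil => simp [bitStringCode]
  | cons b l ih =>
    have : bitStringCode (b :: l) = Nat.bit b (bitStringCode l) := rfl
    rw [this, Nat.bit_val, List.length_cons, pow_succ]
    have : b.toNat ≤ 1 := Bool.toNat_le b
    omega

theorem bitStringCode_injective : Function.Injective bitStringCode := by
  intro l
  induction l with
  | nil =>
    intro l' h
    cases l' with
    | nil => rfl
    | cons b l' =>
      have h' : bitStringCode (b :: l') = Nat.bit b (bitStringCode l') := rfl
      have h1 : bitStringCode [] = 1 := rfl
      have := bitStringCode_pos l'
      rw [h', h1, Nat.bit_val] at h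
      omega
  | cons b l ih =>
    intro l' h
    have hb : bitStringCode (b :: l) = Nat.bit b (bitStringCode l) := rfl
    cases l' with
    | nil =>
      have h1 : bitStringCode [] = 1 := rfl
      have := bitStringCode_pos l
      rw [hb, h1, Nat.bit_val] at h
      omega
    | cons b' l' =>
      have hb' : bitStringCode (b' :: l') = Nat.bit b' (bitStringCode l') := rfl
      rw [hb, hb', Nat.bit_val, Nat.bit_val] at h
      have h1 : b = b' := by
        cases b <;> cases b' <;> simp at h ⊢ <;> omega
      subst h1
      rw [ih (show bitStringCode l = bitStringCode l' by omega)]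

/-! ### Ports -/

namespace PortGraph

variable {n : ℕ}

theorem deg_pos (G : PortGraph n) (hG : G.graph.Connected) (hn : 2 ≤ n) (v : Fin n) :
    0 < G.deg v := by
  have : Nontrivial (Fin n) := Fin.nontrivial_iff_two_le.2 hn
  obtain ⟨u, hu⟩ := hG.preconnected.exists_adj_of_nontrivial v
  have : Nonempty (G.graph.neighborSet v) := ⟨⟨u, hu⟩⟩
  exact Nat.card_pos

theorem deg_le (G : PortGraph n) (v : Fin n) : G.deg v ≤ n := by
  have h := Nat.card_le_card_of_injective (Subtype.val : G.graph.neighborSet v → Fin n)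
    Subtype.val_injective
  rwa [Nat.card_fin] at h

theorem traverse_of_port_eq (G : PortGraph n) {u v : Fin n}
    (x : Fin (Nat.card (G.graph.neighborSet u))) (hv : v ∈ G.graph.neighborSet u)
    (h : G.port u x = ⟨v, hv⟩) :
    G.traverse u x = some (v, ((G.port v).symm ⟨u, SimpleGraph.Adj.symm hv⟩ : ℕ)) := by
  unfold traverse
  rw [dif_pos x.is_lt]
  have key : ∀ y : G.graph.neighborSet u, y = ⟨v, hv⟩ →
      some ((y : Fin n), ((G.port y).symm ⟨u, SimpleGraph.Adj.symm y.2⟩ : ℕ)) =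
        some (v, ((G.port v).symm ⟨u, SimpleGraph.Adj.symm hv⟩ : ℕ)) := by
    rintro _ rfl
    rfl
  exact key _ h

theorem exists_traverse (G : PortGraph n) {v : Fin n} {i : ℕ} (h : i < G.deg v) :
    ∃ u j, G.traverse v i = some (u, j) := by
  unfold traverse
  rw [dif_pos (show i < Nat.card (G.graph.neighborSet v) from h)]
  exact ⟨_, _, rfl⟩

/-- Taking an edge back: the port by which a node was entered leads to where one came from. -/
theorem traverse_symm (G : PortGraph n) {v u : Fin n} {i j : ℕ}
    (h : G.traverse v i = some (u, j)) : G.traverse u j = some (v, i) ∧ j < G.deg u := by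
  unfold traverse at h
  split at h
  · rename_i hi
    simp only [Option.some.injEq, Prod.mk.injEq] at h
    obtain ⟨rfl, rfl⟩ := h
    refine ⟨?_, Fin.is_lt _⟩
    refine (G.traverse_of_port_eq _ (SimpleGraph.Adj.symm (G.port v ⟨i, hi⟩).2)
      (Equiv.apply_symm_apply _ _)).trans ?_
    have key : (G.port v).symm (G.port v ⟨i, hi⟩) = ⟨i, hi⟩ := Equiv.symm_apply_apply _ _
    exact congrArg (fun x : Fin _ => some (v, (x : ℕ))) key
  · simp at h

theorem traverse_ne (G : PortGraph n) {v u : Fin n} {i j : ℕ}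
    (h : G.traverse v i = some (u, j)) : u ≠ v := by
  unfold traverse at h
  split at h
  · rename_i hi
    simp only [Option.some.injEq, Prod.mk.injEq] at h
    obtain ⟨rfl, rfl⟩ := h
    exact (G.port v ⟨i, hi⟩).2.ne'
  · simp at h

end PortGraph

/-! ### Exploration walks -/

namespace ExplorationProcedure

variable {n : ℕ}

/-- The port by which a node of degree `δ`, entered through port `e`, is left in step `i`. -/
def forwardPort (U : ExplorationProcedure) (N i δ e : ℕ) : ℕ :=
  if i = 0 then 0 else (((e : ℤ) + U.seq N (i - 1)) % (δ : ℤ)).toNat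

/-- The port by which a node of degree `δ` was first entered, if it was left through port `e` in
step `i`. -/
def backwardPort (U : ExplorationProcedure) (N i δ e : ℕ) : ℕ :=
  (((e : ℤ) - U.seq N (i - 1)) % (δ : ℤ)).toNat

/-- The port by which the walk leaves its node in step `i`. -/
noncomputable def exitPort (U : ExplorationProcedure) (G : PortGraph n) (N : ℕ) (s : Fin n)
    (i : ℕ) : ℕ :=
  U.forwardPort N i (G.deg (U.walk G N s i).1) (U.walk G N s i).2

theorem exitPort_lt (U : ExplorationProcedure) (G : PortGraph n) (hd : ∀ v, 0 < G.deg v) (N : ℕ)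
    (s : Fin n) (i : ℕ) : U.exitPort G N s i < G.deg (U.walk G N s i).1 := by
  unfold exitPort forwardPort
  have h := hd (U.walk G N s i).1
  split
  · exact h
  · have h' : (0 : ℤ) < G.deg (U.walk G N s i).1 := by exact_mod_cast h
    rw [Int.toNat_lt (Int.emod_nonneg _ h'.ne')]
    exact Int.emod_lt_of_pos _ h'

theorem traverse_exitPort (U : ExplorationProcedure) (G : PortGraph n) (hd : ∀ v, 0 < G.deg v)
    (N : ℕ) (s : Fin n) (i : ℕ) :
    G.traverse (U.walk G N s i).1 (U.exitPort G N s i) = some (U.walk G N s (i + 1)) := by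
  obtain ⟨u, j, h⟩ := G.exists_traverse (U.exitPort_lt G hd N s i)
  rw [h]
  cases i with
  | zero =>
    simp only [exitPort, forwardPort, walk, if_true] at h ⊢
    simp [h]
  | succ i =>
    rw [walk]
    simp only [exitPort, forwardPort, Nat.add_one_ne_zero, if_false, Nat.add_sub_cancel] at h
    simp [h]

theorem traverse_entryPort (U : ExplorationProcedure) (G : PortGraph n) (hd : ∀ v, 0 < G.deg v)
    (N : ℕ) (s : Fin n) (i : ℕ) :
    G.traverse (U.walk G N s (i + 1)).1 (U.walk G N s (i + 1)).2 =
      some ((U.walk G N s i).1, U.exitPort G N s i) :=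
  (G.traverse_symm (U.traverse_exitPort G hd N s i)).1

theorem walk_snd_lt (U : ExplorationProcedure) (G : PortGraph n) (hd : ∀ v, 0 < G.deg v)
    (N : ℕ) (s : Fin n) (i : ℕ) : (U.walk G N s i).2 < G.deg (U.walk G N s i).1 := by
  cases i with
  | zero => exact hd _
  | succ i => exact (G.traverse_symm (U.traverse_exitPort G hd N s i)).2

/-- Subtracting the term again determines the entry port modulo the degree, hence exactly, as ports
are smaller than the degree. Step `0` uses no term and has no entry port to recover. -/
theorem backwardPort_exitPort (U : ExplorationProcedure) (G : PortGraph n)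
    (hd : ∀ v, 0 < G.deg v) (N : ℕ) (s : Fin n) {i : ℕ} (hi : i ≠ 0) :
    U.backwardPort N i (G.deg (U.walk G N s i).1) (U.exitPort G N s i) =
      (U.walk G N s i).2 := by
  have h := U.walk_snd_lt G hd N s i
  unfold backwardPort exitPort forwardPort
  rw [if_neg hi]
  set δ := G.deg (U.walk G N s i).1
  set e := (U.walk G N s i).2
  have hδ : (δ : ℤ) ≠ 0 := by omega
  rw [Int.toNat_of_nonneg (Int.emod_nonneg _ hδ), Int.emod_sub_emod, add_sub_cancel_right,
    Int.emod_eq_of_lt (by omega) (by omega), Int.toNat_natCast]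

theorem mem_succ (U : ExplorationProcedure) (N i : ℕ) :
    U.mem N (i + 1) = U.nextMem N (U.mem N i) := by
  simp only [mem, Function.iterate_succ_apply']

/-- The number of steps after which a walk with `M N` bits of memory in a graph with at most `N`
nodes runs in circles, or the given bound `X N` if that is smaller. -/
def cutoff (X M : ℕ → ℕ) (N : ℕ) : ℕ := min (X N) (N ^ 2 * 2 ^ (M N + 1) + 1)

/-- A walk with little memory visits all nodes early. -/
theorem exists_le_cutoff (U : ExplorationProcedure) {𝒢 : ∀ n : ℕ, PortGraph n → Prop}
    {X M : ℕ → ℕ} (hU : U.IsUXS 𝒢 X) (hM : U.UsesMemory X M) (G : PortGraph n) (hG : 𝒢 n G)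
    (hc : G.graph.Connected) (hd : ∀ v, 0 < G.deg v) (s v : Fin n) :
    ∃ t ≤ cutoff X M n, (U.walk G n s t).1 = v := by
  have hex : ∃ t, (U.walk G n s t).1 = v := by
    obtain ⟨t, -, ht⟩ := hU n n le_rfl G hG hc s v
    exact ⟨t, ht⟩
  classical
  refine ⟨Nat.find hex, le_min ?_ ?_, Nat.find_spec hex⟩
  · obtain ⟨t, ht, htv⟩ := hU n n le_rfl G hG hc s v
    exact (Nat.find_min' hex htv).trans ht
  by_contra! hlt
  have hX : n ^ 2 * 2 ^ (M n + 1) < X n := by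
    obtain ⟨t, ht, htv⟩ := hU n n le_rfl G hG hc s v
    have := Nat.find_min' hex htv
    omega
  set K := n ^ 2 * 2 ^ (M n + 1) with hK
  -- The configuration that determines the rest of the walk. It is taken after the first move, which
  -- obeys a special rule; the step from `t + 1` to `t + 2` uses the term produced from `U.mem n t`.
  let f : ℕ → Fin n × ℕ × ℕ := fun t =>
    ((U.walk G n s (t + 1)).1, (U.walk G n s (t + 1)).2, bitStringCode (U.mem n t))
  have hcard : ((Finset.univ : Finset (Fin n)) ×ˢ
      (Finset.range n ×ˢ Finset.range (2 ^ (M n + 1)))).card < (Finset.range (K + 1)).card := by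
    rw [Finset.card_product, Finset.card_product]
    simp only [Finset.card_univ, Fintype.card_fin, Finset.card_range]
    rw [hK, pow_two, mul_assoc]
    omega
  have hmaps : Set.MapsTo f (Finset.range (K + 1))
      ((Finset.univ : Finset (Fin n)) ×ˢ
        (Finset.range n ×ˢ Finset.range (2 ^ (M n + 1))) : Finset _) := by
    intro t ht
    have ht' : t < K + 1 := by simpa using ht
    have h1 := (U.walk_snd_lt G hd n s (t + 1)).trans_le (G.deg_le _)
    have h2 : bitStringCode (U.mem n t) < 2 ^ (M n + 1) :=
      (bitStringCode_lt _).trans_le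
        (Nat.pow_le_pow_right two_pos (Nat.succ_le_succ (hM n t (by omega))))
    simp [f, h1, h2]
  obtain ⟨a, ha, b, hb, hab, hfab⟩ :=
    Finset.exists_ne_map_eq_of_card_lt_of_maps_to hcard hmaps
  wlog hlt' : a < b generalizing a b
  · exact this b hb a ha hab.symm hfab.symm (by omega)
  have hper : ∀ d, U.walk G n s (a + 1 + d) = U.walk G n s (b + 1 + d) ∧
      U.mem n (a + d) = U.mem n (b + d) := by
    intro d
    induction d with
    | zero =>
      simp only [f, Prod.mk.injEq] at hfab
      exact ⟨Prod.ext hfab.1 hfab.2.1, bitStringCode_injective hfab.2.2⟩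
    | succ d ih =>
      obtain ⟨ih1, ih2⟩ := ih
      constructor
      · have e : ∀ c, c + 1 + (d + 1) = (c + d) + 2 := fun c => by omega
        have e' : ∀ c, c + d + 1 = c + 1 + d := fun c => by omega
        rw [e, e, walk, walk, e', e', ih1, seq, seq, ih2]
      · rw [← add_assoc, ← add_assoc, mem_succ, mem_succ, ih2]
  -- The first visit to `v` comes after the repetition, so shifting it back by the period `b - a`
  -- gives an earlier visit.
  have hbK : b < K + 1 := by simpa using hb
  have h := (hper (Nat.find hex - (b + 1))).1
  rw [show b + 1 + (Nat.find hex - (b + 1)) = Nat.find hex by omega] at h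
  exact Nat.find_min hex (m := a + 1 + (Nat.find hex - (b + 1))) (by omega)
    (by rw [h]; exact Nat.find_spec hex)

end ExplorationProcedure

/-! ### Ranks -/

/-- Among finitely many robots with distinct numbers, exactly `min c (card P)` have fewer than `c`
smaller ones. -/
theorem card_filter_rank_lt {α : Type*} [DecidableEq α] (P : Finset α) (f : α → ℕ)
    (hf : Function.Injective f) (c : ℕ) :
    (P.filter fun a => (P.filter fun b => f b < f a).card < c).card = min c P.card := by
  let rank : α → ℕ := fun a => (P.filter fun b => f b < f a).card
  have hmono : ∀ a ∈ P, ∀ b, f a < f b → rank a < rank b := by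
    intro a ha b hab
    apply Finset.card_lt_card
    rw [Finset.ssubset_iff_of_subset]
    · exact ⟨a, by simp [ha, hab], by simp⟩
    · intro x hx
      simp only [Finset.mem_filter] at hx ⊢
      exact ⟨hx.1, hx.2.trans hab⟩
  have hinj : Set.InjOn rank P := by
    intro a ha b hb hab
    by_contra hne
    rcases lt_or_gt_of_ne (fun h => hne (hf h) : f a ≠ f b) with h | h
    · exact absurd hab (hmono a ha b h).ne
    · exact absurd hab (hmono b hb a h).ne'
  -- Distinct ranks below `P.card` must take every value in that range.
  have himg : P.image rank = Finset.range P.card := by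
    apply Finset.eq_of_subset_of_card_le
    · intro x hx
      obtain ⟨a, ha, rfl⟩ := Finset.mem_image.1 hx
      rw [Finset.mem_range]
      exact Finset.card_lt_card (Finset.filter_ssubset.2 ⟨a, ha, by simp⟩)
    · rw [Finset.card_image_of_injOn hinj, Finset.card_range]
  have h1 : ((P.filter fun a => rank a < c).image rank) = Finset.range (min c P.card) := by
    rw [← Finset.filter_image (p := fun x => x < c), himg]
    ext x
    simp only [Finset.mem_filter, Finset.mem_range]
    omega
  rw [← Finset.card_range (min c P.card), ← h1, Finset.card_image_of_injOn]
  exact hinj.mono (by intro x; simp only [Finset.coe_filter]; exact fun h => h.1)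

/-! ### The herding algorithm

The shepherd walks along a covering walk of length `Λ` four times, forth and back and forth and
back. On the first way it gathers all robots, on the second one it lets robots settle down
wherever there is room, on the third one it dismisses them. On the way back it stops at a node with
room left, which it has noticed while the others settled down. -/

/-- The messages: a robot tells its ID, the shepherd gives orders. -/
inductive HerdMsg where
  | robot (ID : ℕ)
  | gather (port : ℕ)
  | settle (port : ℕ)
  | dismiss

/-- The ID told by a robot. -/
def HerdMsg.senderID : HerdMsg → ℕ
  | .robot a => a
  | _ => 0

namespace Herding

/-- Memory content of the shepherd: the number of nodes, the current round, and the place on the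
walk at which room was noticed last. -/
def encode (N t τ : ℕ) : List Bool := (Nat.pair N (Nat.pair t τ)).bits

def numNodes (l : List Bool) : ℕ := (natOfBits l).unpair.1

def clock (l : List Bool) : ℕ := (natOfBits l).unpair.2.unpair.1

def refuge (l : List Bool) : ℕ := (natOfBits l).unpair.2.unpair.2

@[simp] theorem numNodes_encode (N t τ : ℕ) : numNodes (encode N t τ) = N := by
  simp [numNodes, encode, natOfBits_bits]

@[simp] theorem clock_encode (N t τ : ℕ) : clock (encode N t τ) = t := by
  simp [clock, encode, natOfBits_bits]

@[simp] theorem refuge_encode (N t τ : ℕ) : refuge (encode N t τ) = τ := by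
  simp [refuge, encode, natOfBits_bits]

/-- Rounds since the shepherd last set out from the start of a walk of length `L`. -/
def tick (L t : ℕ) : ℕ := if t < 2 * L then t else t - 2 * L

/-- Index of the shepherd's place on the walk in round `t`. -/
def patrolIndex (L t : ℕ) : ℕ := if tick L t ≤ L then tick L t else 2 * L - tick L t

/-- The port by which the shepherd leaves its node in round `t`. -/
def shepherdPort (U : ExplorationProcedure) (Λ : ℕ → ℕ) (N t : ℕ) (w : LocalView) : ℕ :=
  if tick (Λ N) t < Λ N then U.forwardPort N (tick (Λ N) t) w.deg (w.entry.getD 0)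
  else if tick (Λ N) t = Λ N then w.entry.getD 0
  else U.backwardPort N (2 * Λ N - tick (Λ N) t) w.deg (w.entry.getD 0)

/-- The order given by the shepherd in round `t`. -/
def order (U : ExplorationProcedure) (Λ : ℕ → ℕ) (N t : ℕ) (w : LocalView) : HerdMsg :=
  if t < Λ N then .gather (shepherdPort U Λ N t w)
  else if t < 2 * Λ N then .settle (shepherdPort U Λ N t w)
  else .dismiss

/-- The new refuge if `h` robots are heard at a node with capacity `c` in round `t`. -/
def updateRefuge (L t τ h c : ℕ) : ℕ :=
  if L ≤ t ∧ t ≤ 2 * L ∧ h < c then 2 * L - t else τ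

/-- What a robot does when it has heard an order; `a` of the other robots at its node, which has
capacity `c`, have smaller IDs. -/
def obey (a c : ℕ) : Option HerdMsg → RobotAction
  | some (.gather i) => .move i
  | some (.settle i) => if a < c then .stay else .move i
  | some .dismiss => .terminate
  | _ => .stay

/-- The herding algorithm along the walks of `U` of length `Λ N`. -/
def algorithm (U : ExplorationProcedure) (Λ : ℕ → ℕ) : RobotAlgorithm where
  Msg := HerdMsg
  -- On a single node there are no edges, and the memory bound may allow no bit at all.
  shepherdInit N _ := if N = 1 then [] else encode N 0 0
  robotInit a := a.bits
  shepherdSay l w := order U Λ (numNodes l) (clock l) w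
  robotSay l _ := .robot (natOfBits l)
  shepherdStep l w h :=
    if w.deg = 0 then (l, .terminate)
    else if 3 * Λ (numNodes l) ≤ clock l ∧ refuge l = 4 * Λ (numNodes l) - clock l then
      (l, .terminate)
    else
      -- The cap on the clock bounds the memory in every round without recourse to the correctness
      -- proof.
      (encode (numNodes l) (min (clock l + 1) (4 * Λ (numNodes l)))
        (updateRefuge (Λ (numNodes l)) (clock l) (refuge l) h.card w.cap),
        .move (shepherdPort U Λ (numNodes l) (clock l) w))
  robotStep l w o h :=
    (l, if w.deg = 0 then .terminate
      else obey (h.countP fun m => m.senderID < natOfBits l) w.cap o)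

/-! ### The effect of a single round -/

section Correctness

open RobotAlgorithm

variable {n k : ℕ} (U : ExplorationProcedure) (Λ : ℕ → ℕ) (S : Scenario n k)

/-- The node visited by the walk of the shepherd at index `i`. -/
noncomputable def site (i : ℕ) : Fin n := (U.walk S.G n (S.start S.shepherd) i).1

/-- The shepherd is on its patrol at the beginning of round `t`. -/
structure ShepherdAt (t τ : ℕ) (ρ : RobotState n) : Prop where
  pos : ρ.pos = site U S (patrolIndex (Λ n) t)
  mem : ρ.mem = encode n t τ
  entry_forward : tick (Λ n) t ≠ 0 → tick (Λ n) t ≤ Λ n →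
    ρ.entry = some (U.walk S.G n (S.start S.shepherd) (tick (Λ n) t)).2
  entry_backward : Λ n < tick (Λ n) t →
    ρ.entry = some (U.exitPort S.G n (S.start S.shepherd) (2 * Λ n - tick (Λ n) t))
  active : ρ.terminated = false

/-- The other robots at node `v`. -/
def flock (σ : Fin k → RobotState n) (v : Fin n) : Finset (Fin k) :=
  Finset.univ.filter fun r => r ≠ S.shepherd ∧ (σ r).pos = v

variable {U Λ S}

theorem mem_flock {σ : Fin k → RobotState n} {v : Fin n} {r : Fin k} :
    r ∈ flock S σ v ↔ r ≠ S.shepherd ∧ (σ r).pos = v := by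
  simp [flock]

/-- On the way out the entry port is that of the walk. At the turning point it leads straight back.
After that, each node is entered through the port by which the walk had left it, which is what
`backwardPort` needs. -/
theorem ShepherdAt.traverse_shepherdPort (hd : ∀ v, 0 < S.G.deg v) {t τ : ℕ} {ρ : RobotState n}
    (hρ : ShepherdAt U Λ S t τ ρ) (ht : t < 4 * Λ n) :
    ∃ j, S.G.traverse ρ.pos (shepherdPort U Λ n t (view S ρ)) =
        some (site U S (patrolIndex (Λ n) (t + 1)), j) ∧
      (tick (Λ n) (t + 1) ≠ 0 → tick (Λ n) (t + 1) ≤ Λ n →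
        j = (U.walk S.G n (S.start S.shepherd) (tick (Λ n) (t + 1))).2) ∧
      (Λ n < tick (Λ n) (t + 1) →
        j = U.exitPort S.G n (S.start S.shepherd) (2 * Λ n - tick (Λ n) (t + 1))) := by
  obtain ⟨hpos, -, hf, hb, -⟩ := hρ
  have hview : (view S ρ).deg = S.G.deg (site U S (patrolIndex (Λ n) t)) := by
    simp [view, hpos]
  have hentry : (view S ρ).entry = ρ.entry := rfl
  have htick : tick (Λ n) t < 2 * Λ n := by unfold tick; split <;> omega
  unfold shepherdPort
  rw [hview, hentry, hpos]
  by_cases h1 : tick (Λ n) t < Λ n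
  · have hsucc : tick (Λ n) (t + 1) = tick (Λ n) t + 1 := by
      unfold tick at h1 ⊢; split_ifs at h1 ⊢ <;> omega
    have hidx : patrolIndex (Λ n) t = tick (Λ n) t := if_pos h1.le
    have hidx' : patrolIndex (Λ n) (t + 1) = tick (Λ n) t + 1 := by
      unfold patrolIndex; rw [hsucc, if_pos (by omega)]
    rw [if_pos h1, hidx, hidx', hsucc]
    refine ⟨_, ?_, fun _ _ => rfl, fun h => by omega⟩
    have key := U.traverse_exitPort S.G hd n (S.start S.shepherd) (tick (Λ n) t)
    have hport : U.forwardPort n (tick (Λ n) t) (S.G.deg (site U S (tick (Λ n) t)))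
        (ρ.entry.getD 0) = U.exitPort S.G n (S.start S.shepherd) (tick (Λ n) t) := by
      unfold ExplorationProcedure.exitPort
      by_cases h0 : tick (Λ n) t = 0
      · simp [ExplorationProcedure.forwardPort, h0]
      · rw [hf h0 h1.le]
        rfl
    rw [hport]
    exact key
  -- The tick drops to `0` when the shepherd is back at its start in round `2 * Λ n`, where the
  -- second patrol begins.
  · have hsucc : tick (Λ n) (t + 1) = 0 ∨ tick (Λ n) (t + 1) = tick (Λ n) t + 1 := by
      unfold tick at h1 ⊢; split_ifs at h1 ⊢ <;> omega
    have hsucc' : tick (Λ n) (t + 1) = 0 → tick (Λ n) t + 1 = 2 * Λ n := by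
      intro h0
      unfold tick at h0 h1 ⊢; split_ifs at h0 h1 ⊢ <;> omega
    obtain ⟨i, hi⟩ : ∃ i, 2 * Λ n - tick (Λ n) t = i + 1 :=
      ⟨2 * Λ n - tick (Λ n) t - 1, by omega⟩
    have hidx : patrolIndex (Λ n) t = i + 1 := by
      unfold patrolIndex; split_ifs <;> omega
    have hidx' : patrolIndex (Λ n) (t + 1) = i := by
      unfold patrolIndex; split_ifs <;> omega
    have key := U.traverse_entryPort S.G hd n (S.start S.shepherd) i
    have hport : (if tick (Λ n) t = Λ n then ρ.entry.getD 0 else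
        U.backwardPort n (2 * Λ n - tick (Λ n) t) (S.G.deg (site U S (i + 1)))
          (ρ.entry.getD 0)) = (U.walk S.G n (S.start S.shepherd) (i + 1)).2 := by
      split_ifs with h2
      · rw [hf (by omega) h2.le, show tick (Λ n) t = i + 1 by omega]
        rfl
      · rw [hb (by omega), hi]
        exact U.backwardPort_exitPort S.G hd n (S.start S.shepherd) (Nat.succ_ne_zero i)
    rw [if_neg h1, hidx, hidx', hport]
    refine ⟨_, key, fun h h' => by omega, fun h => ?_⟩
    rw [show 2 * Λ n - tick (Λ n) (t + 1) = i by omega]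

/-- Terminated robots are silent, so the shepherd can count heads only before any dismissal takes
effect. -/
theorem heard_shepherd_card {σ : Fin k → RobotState n}
    (hact : ∀ r, r ≠ S.shepherd → (σ r).terminated = false) :
    ((algorithm U Λ).heard S σ S.shepherd).card = (flock S σ (σ S.shepherd).pos).card := by
  rw [RobotAlgorithm.heard, Multiset.card_map, Finset.card_val]
  refine congrArg Finset.card (Finset.ext fun r => ?_)
  rw [Finset.mem_filter, mem_flock]
  constructor
  · rintro ⟨-, h, -, h', -⟩
    exact ⟨h, h'⟩
  · rintro ⟨h, h'⟩
    exact ⟨Finset.mem_univ r, h, h, h', hact r h⟩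

theorem round_shepherd (hd : ∀ v, 0 < S.G.deg v) {t τ : ℕ} {σ : Fin k → RobotState n}
    (hs : ShepherdAt U Λ S t τ (σ S.shepherd)) (ht : t < 4 * Λ n)
    (hgo : ¬ (3 * Λ n ≤ t ∧ τ = 4 * Λ n - t)) :
    ShepherdAt U Λ S (t + 1)
      (updateRefuge (Λ n) t τ ((algorithm U Λ).heard S σ S.shepherd).card
        (S.cap (σ S.shepherd).pos)) ((algorithm U Λ).round S σ S.shepherd) := by
  obtain ⟨j, hj, hjf, hjb⟩ := hs.traverse_shepherdPort hd ht
  have hdeg : (view S (σ S.shepherd)).deg ≠ 0 := (hd _).ne'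
  have hround : (algorithm U Λ).round S σ S.shepherd =
      ⟨site U S (patrolIndex (Λ n) (t + 1)), encode n (t + 1)
        (updateRefuge (Λ n) t τ ((algorithm U Λ).heard S σ S.shepherd).card
          (S.cap (σ S.shepherd).pos)), some j, false⟩ := by
    simp only [RobotAlgorithm.round, hs.active, Bool.false_eq_true, if_false,
      RobotAlgorithm.compute, if_true]
    simp only [algorithm, if_neg hdeg, hs.mem, numNodes_encode, clock_encode, refuge_encode,
      if_neg hgo, act, hj]
    rw [min_eq_left (by omega)]
    rfl
  rw [hround]
  exact ⟨rfl, rfl, fun h h' => congrArg some (hjf h h'), fun h => congrArg some (hjb h), rfl⟩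

theorem round_shepherd_terminate {t τ : ℕ} {σ : Fin k → RobotState n}
    (hs : ShepherdAt U Λ S t τ (σ S.shepherd)) (hhome : 3 * Λ n ≤ t ∧ τ = 4 * Λ n - t) :
    ((algorithm U Λ).round S σ S.shepherd).terminated = true ∧
      ((algorithm U Λ).round S σ S.shepherd).pos = (σ S.shepherd).pos := by
  simp only [RobotAlgorithm.round, hs.active, Bool.false_eq_true, if_false,
    RobotAlgorithm.compute, if_true]
  simp only [algorithm, hs.mem, numNodes_encode, clock_encode, refuge_encode, if_pos hhome]
  split_ifs <;> simp [act]

theorem act_mem (ρ : RobotState n) (l : List Bool) (a : RobotAction) :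
    (act S ρ l a).mem = l := by
  cases a with
  | stay => rfl
  | terminate => rfl
  | move i =>
    simp only [act]
    split <;> rfl

/-- Serves twice: it bounds the memory of these robots, and it makes the IDs they announce correct
in every round. -/
theorem run_mem (t : ℕ) {r : Fin k} (hr : r ≠ S.shepherd) :
    ((algorithm U Λ).run S t r).mem = (S.ID r).bits := by
  induction t with
  | zero => simp [RobotAlgorithm.run, hr, algorithm]
  | succ t ih =>
    simp only [RobotAlgorithm.run, RobotAlgorithm.round, RobotAlgorithm.compute, if_neg hr]
    split_ifs with h
    · exact ih
    · rw [← ih]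
      simp only [algorithm, act_mem]

/-- The robots other than the shepherd carry their IDs. -/
def CarryIDs (S : Scenario n k) (σ : Fin k → RobotState n) : Prop :=
  ∀ r, r ≠ S.shepherd → (σ r).mem = (S.ID r).bits

theorem round_of_ne {σ : Fin k → RobotState n} {r : Fin k} (hr : r ≠ S.shepherd)
    (h : (σ r).pos ≠ (σ S.shepherd).pos) (hd : ∀ v, 0 < S.G.deg v) :
    ((algorithm U Λ).round S σ r).pos = (σ r).pos ∧
      ((algorithm U Λ).round S σ r).terminated = (σ r).terminated := by
  have hdeg : (view S (σ r)).deg ≠ 0 := (hd _).ne'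
  have hh : (algorithm U Λ).heardShepherd S σ r = none := by
    rw [RobotAlgorithm.heardShepherd, if_neg]
    exact fun h' => h h'.2.1.symm
  simp only [RobotAlgorithm.round, RobotAlgorithm.compute, if_neg hr, hh]
  simp only [algorithm, if_neg hdeg, obey, act]
  cases h' : (σ r).terminated <;> simp [h']

theorem heardShepherd_eq {t τ : ℕ} {σ : Fin k → RobotState n}
    (hs : ShepherdAt U Λ S t τ (σ S.shepherd)) {r : Fin k} (hr : r ≠ S.shepherd)
    (h : (σ r).pos = (σ S.shepherd).pos) :
    (algorithm U Λ).heardShepherd S σ r = some (order U Λ n t (view S (σ S.shepherd))) := by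
  rw [RobotAlgorithm.heardShepherd, if_pos ⟨hr.symm, h.symm, hs.active⟩, RobotAlgorithm.say,
    if_pos rfl]
  simp only [algorithm, hs.mem, numNodes_encode, clock_encode]

theorem round_gather (hd : ∀ v, 0 < S.G.deg v) {t τ : ℕ} {σ : Fin k → RobotState n}
    (hs : ShepherdAt U Λ S t τ (σ S.shepherd)) (ht : t < Λ n) {r : Fin k}
    (hr : r ≠ S.shepherd) (hact : (σ r).terminated = false)
    (h : (σ r).pos = (σ S.shepherd).pos) :
    ((algorithm U Λ).round S σ r).pos = site U S (patrolIndex (Λ n) (t + 1)) ∧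
      ((algorithm U Λ).round S σ r).terminated = false := by
  obtain ⟨j, hj, -, -⟩ := hs.traverse_shepherdPort hd (by omega)
  have hdeg : (view S (σ r)).deg ≠ 0 := (hd _).ne'
  have ho : order U Λ n t (view S (σ S.shepherd)) =
      .gather (shepherdPort U Λ n t (view S (σ S.shepherd))) := if_pos ht
  simp only [RobotAlgorithm.round, RobotAlgorithm.compute, if_neg hr,
    heardShepherd_eq hs hr h, hact, Bool.false_eq_true, if_false, ho]
  simp only [algorithm, if_neg hdeg, obey, act, h, hj, and_self]

theorem round_dismiss {t τ : ℕ} {σ : Fin k → RobotState n}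
    (hs : ShepherdAt U Λ S t τ (σ S.shepherd)) (ht : 2 * Λ n ≤ t) {r : Fin k}
    (hr : r ≠ S.shepherd) (h : (σ r).pos = (σ S.shepherd).pos) :
    ((algorithm U Λ).round S σ r).pos = (σ r).pos ∧
      ((algorithm U Λ).round S σ r).terminated = true := by
  have ho : order U Λ n t (view S (σ S.shepherd)) = .dismiss := by
    rw [order, if_neg (by omega), if_neg (by omega)]
  simp only [RobotAlgorithm.round, RobotAlgorithm.compute, if_neg hr,
    heardShepherd_eq hs hr h, ho]
  simp only [algorithm, obey, ite_self, act]
  cases h' : (σ r).terminated <;> simp [h']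

/-- The number of other robots at the node of `r` with smaller IDs. -/
def rank (S : Scenario n k) (σ : Fin k → RobotState n) (r : Fin k) : ℕ :=
  ((flock S σ (σ r).pos).filter fun r' => S.ID r' < S.ID r).card

/-- A robot does not hear itself, but it does not count among the smaller IDs either, so the
messages yield its rank in the whole flock. -/
theorem countP_heard {σ : Fin k → RobotState n} (hID : CarryIDs S σ)
    (hact : ∀ r, r ≠ S.shepherd → (σ r).terminated = false) {r : Fin k}
    (hr : r ≠ S.shepherd) :
    ((algorithm U Λ).heard S σ r).countP
      (fun m : HerdMsg => m.senderID < natOfBits (σ r).mem) = rank S σ r := by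
  rw [RobotAlgorithm.heard]
  refine (Multiset.countP_map (β := HerdMsg) ((algorithm U Λ).say S σ) _
    (fun m : HerdMsg => m.senderID < natOfBits (σ r).mem)).trans ?_
  rw [← Finset.filter_val, Finset.card_val]
  refine congrArg Finset.card (Finset.ext fun r' => ?_)
  rw [Finset.mem_filter, Finset.mem_filter, Finset.mem_filter, mem_flock, hID r hr,
    natOfBits_bits, RobotAlgorithm.say]
  constructor
  · rintro ⟨⟨-, h1, -, h2, -⟩, h3⟩
    rw [if_neg h1] at h3
    simp only [algorithm, HerdMsg.senderID, hID r' h1, natOfBits_bits] at h3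
    exact ⟨⟨h1, h2⟩, h3⟩
  · rintro ⟨⟨h1, h2⟩, h3⟩
    refine ⟨⟨Finset.mem_univ r', h1, ?_, h2, hact r' h1⟩, ?_⟩
    · rintro rfl
      exact lt_irrefl _ h3
    · rw [if_neg h1]
      simpa only [algorithm, HerdMsg.senderID, hID r' h1, natOfBits_bits] using h3

theorem round_settle (hd : ∀ v, 0 < S.G.deg v) {t τ : ℕ} {σ : Fin k → RobotState n}
    (hID : CarryIDs S σ) (hact : ∀ r, r ≠ S.shepherd → (σ r).terminated = false)
    (hs : ShepherdAt U Λ S t τ (σ S.shepherd)) (ht : Λ n ≤ t) (ht' : t < 2 * Λ n) {r : Fin k}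
    (hr : r ≠ S.shepherd) (h : (σ r).pos = (σ S.shepherd).pos) :
    ((algorithm U Λ).round S σ r).pos =
        (if rank S σ r < S.cap (σ r).pos then (σ r).pos
          else site U S (patrolIndex (Λ n) (t + 1))) ∧
      ((algorithm U Λ).round S σ r).terminated = false := by
  obtain ⟨j, hj, -, -⟩ := hs.traverse_shepherdPort hd (by omega)
  have hdeg : (view S (σ r)).deg ≠ 0 := (hd _).ne'
  have ho : order U Λ n t (view S (σ S.shepherd)) =
      .settle (shepherdPort U Λ n t (view S (σ S.shepherd))) := by
    rw [order, if_neg (by omega), if_pos ht']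
  have hc := countP_heard (U := U) (Λ := Λ) hID hact hr
  have hcap : (view S (σ r)).cap = S.cap (σ r).pos := rfl
  have hact' := hact r hr
  have hcomp : (algorithm U Λ).compute S σ r = ((σ r).mem,
      if rank S σ r < S.cap (σ r).pos then .stay
      else .move (shepherdPort U Λ n t (view S (σ S.shepherd)))) := by
    rw [RobotAlgorithm.compute, if_neg hr, heardShepherd_eq hs hr h, ho, ← hc, ← hcap]
    simp only [algorithm, if_neg hdeg, obey]
    rfl
  simp only [RobotAlgorithm.round, hact', Bool.false_eq_true, if_false, hcomp]
  split_ifs with h1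
  · simp [act]
  · simp [act, h, hj]

theorem patrolIndex_of_le {L t : ℕ} (hL : 0 < L) (h : t ≤ L) : patrolIndex L t = t := by
  have : tick L t = t := if_pos (by omega)
  rw [patrolIndex, this, if_pos h]

theorem patrolIndex_add {L b : ℕ} (h : b ≤ L) : patrolIndex L (L + b) = L - b := by
  unfold patrolIndex tick
  split_ifs <;> omega

theorem patrolIndex_two_mul_add {L i : ℕ} (h : i ≤ L) :
    patrolIndex L (2 * L + i) = i := by
  unfold patrolIndex tick
  split_ifs <;> omega

theorem patrolIndex_four_mul_sub {L i : ℕ} (hL : 0 < L) (h : i ≤ L) :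
    patrolIndex L (4 * L - i) = i := by
  unfold patrolIndex tick
  split_ifs <;> omega

/-! ### First way: gathering -/

theorem carryIDs_run (t : ℕ) : CarryIDs S ((algorithm U Λ).run S t) := fun _ hr => run_mem t hr

/-- First way: the robots on the part of the walk that has been covered follow the shepherd. -/
theorem run_gather (hd : ∀ v, 0 < S.G.deg v) (hn : n ≠ 1) (hL : 0 < Λ n) (t : ℕ) (ht : t ≤ Λ n) :
    ShepherdAt U Λ S t 0 ((algorithm U Λ).run S t S.shepherd) ∧
      ∀ r, r ≠ S.shepherd → ((algorithm U Λ).run S t r).terminated = false ∧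
        ∀ i ≤ t, ((algorithm U Λ).run S t r).pos = site U S i →
          ((algorithm U Λ).run S t r).pos = site U S t := by
  induction t with
  | zero =>
    have h0 : tick (Λ n) 0 = 0 := by simp [tick]
    refine ⟨⟨?_, ?_, fun h => absurd h0 h, fun h => by omega, rfl⟩, fun r hr => ⟨rfl, ?_⟩⟩
    · simp [RobotAlgorithm.run, patrolIndex, h0, site, ExplorationProcedure.walk]
    · simp [RobotAlgorithm.run, algorithm, hn]
    · intro i hi h
      rwa [Nat.le_zero.1 hi] at h
  | succ t ih =>
    obtain ⟨hs, hr⟩ := ih (by omega)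
    have hidx := patrolIndex_of_le hL (show t ≤ Λ n by omega)
    have hidx' := patrolIndex_of_le hL ht
    constructor
    · have := round_shepherd hd hs (by omega) (by omega)
      rwa [updateRefuge, if_neg (by omega)] at this
    · intro r hne
      obtain ⟨hact, hpos⟩ := hr r hne
      by_cases h : ((algorithm U Λ).run S t r).pos = ((algorithm U Λ).run S t S.shepherd).pos
      · obtain ⟨h1, h2⟩ := round_gather hd hs (by omega) hne hact h
        rw [hidx'] at h1
        exact ⟨h2, fun _ _ _ => h1⟩
      · obtain ⟨h1, h2⟩ := round_of_ne (U := U) (Λ := Λ) hne h hd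
        refine ⟨h2.trans hact, fun i hi hi' => ?_⟩
        rcases Nat.lt_or_ge t i with hlt | hle
        · rwa [show i = t + 1 by omega] at hi'
        · refine absurd ?_ h
          rw [hs.pos, hidx]
          exact hpos i hle (h1.symm.trans hi')

/-! ### Second way: settling -/

/-- The situation in the course of the second way, when the shepherd is `b` steps from the end of
the walk: outside its node no capacity is exceeded, and either all robots have found room and the
refuge has more of it, or all nodes that it has left on this way are full. -/
structure Settling (U : ExplorationProcedure) (Λ : ℕ → ℕ) (S : Scenario n k) (b τ : ℕ)
    (σ : Fin k → RobotState n) : Prop where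
  shepherd : ShepherdAt U Λ S (Λ n + b) τ (σ S.shepherd)
  active : ∀ r, r ≠ S.shepherd → (σ r).terminated = false
  card_le : ∀ v, v ≠ site U S (Λ n - b) → (flock S σ v).card ≤ S.cap v
  settled_or_full :
    ((∀ v, (flock S σ v).card ≤ S.cap v) ∧ τ ≤ Λ n ∧
      (flock S σ (site U S τ)).card < S.cap (site U S τ)) ∨
    ∀ i < b, S.cap (site U S (Λ n - i)) ≤ (flock S σ (site U S (Λ n - i))).card

/-- Without loops, robots sent away from an overfull node really leave it. -/
theorem site_succ_ne (hd : ∀ v, 0 < S.G.deg v) (i : ℕ) : site U S (i + 1) ≠ site U S i :=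
  S.G.traverse_ne (U.traverse_exitPort S.G hd n (S.start S.shepherd) i)

theorem flock_settle_self (hd : ∀ v, 0 < S.G.deg v) (hinj : Function.Injective S.ID)
    {t τ : ℕ} {σ : Fin k → RobotState n} (hID : CarryIDs S σ)
    (hact : ∀ r, r ≠ S.shepherd → (σ r).terminated = false)
    (hs : ShepherdAt U Λ S t τ (σ S.shepherd)) (ht : Λ n ≤ t) (ht' : t < 2 * Λ n)
    (hne : site U S (patrolIndex (Λ n) (t + 1)) ≠ (σ S.shepherd).pos) :
    (flock S ((algorithm U Λ).round S σ) (σ S.shepherd).pos).card =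
      min (S.cap (σ S.shepherd).pos) (flock S σ (σ S.shepherd).pos).card := by
  rw [← card_filter_rank_lt _ S.ID hinj]
  refine congrArg Finset.card (Finset.ext fun r => ?_)
  rw [Finset.mem_filter, mem_flock, mem_flock]
  constructor
  · rintro ⟨hr, h⟩
    by_cases h' : (σ r).pos = (σ S.shepherd).pos
    · refine ⟨⟨hr, h'⟩, ?_⟩
      rw [(round_settle hd hID hact hs ht ht' hr h').1] at h
      split_ifs at h with h2
      · rwa [rank, h'] at h2
      · exact absurd h hne
    · rw [(round_of_ne hr h' hd).1] at h
      exact absurd h h'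
  · rintro ⟨⟨hr, h⟩, h2⟩
    refine ⟨hr, ?_⟩
    rw [(round_settle hd hID hact hs ht ht' hr h).1, rank, h, if_pos h2]

/-- Only robots next to the shepherd receive orders to move; elsewhere a node can gain robots but
not lose any, so full nodes stay full. -/
theorem flock_subset_settle (hd : ∀ v, 0 < S.G.deg v) {σ : Fin k → RobotState n} {v : Fin n}
    (hv : v ≠ (σ S.shepherd).pos) :
    flock S σ v ⊆ flock S ((algorithm U Λ).round S σ) v := by
  intro r h
  rw [mem_flock] at h ⊢
  exact ⟨h.1, (round_of_ne h.1 (by rw [h.2]; exact hv) hd).1.trans h.2⟩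

theorem flock_settle_of_ne (hd : ∀ v, 0 < S.G.deg v) {t τ : ℕ} {σ : Fin k → RobotState n}
    (hID : CarryIDs S σ) (hact : ∀ r, r ≠ S.shepherd → (σ r).terminated = false)
    (hs : ShepherdAt U Λ S t τ (σ S.shepherd)) (ht : Λ n ≤ t) (ht' : t < 2 * Λ n) {v : Fin n}
    (hv : v ≠ (σ S.shepherd).pos) (hv' : v ≠ site U S (patrolIndex (Λ n) (t + 1))) :
    flock S ((algorithm U Λ).round S σ) v = flock S σ v := by
  refine (flock_subset_settle hd hv).antisymm' fun r h => ?_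
  rw [mem_flock] at h ⊢
  obtain ⟨hr, h⟩ := h
  refine ⟨hr, ?_⟩
  by_cases h' : (σ r).pos = (σ S.shepherd).pos
  · rw [(round_settle hd hID hact hs ht ht' hr h').1] at h
    split_ifs at h with h2
    · exact h
    · exact absurd h.symm hv'
  · exact (round_of_ne hr h' hd).1.symm.trans h

/-- Nobody leaves a node with enough room. -/
theorem flock_settle_of_card_le (hd : ∀ v, 0 < S.G.deg v) {t τ : ℕ}
    {σ : Fin k → RobotState n} (hID : CarryIDs S σ)
    (hact : ∀ r, r ≠ S.shepherd → (σ r).terminated = false)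
    (hs : ShepherdAt U Λ S t τ (σ S.shepherd)) (ht : Λ n ≤ t) (ht' : t < 2 * Λ n)
    (hc : (flock S σ (σ S.shepherd).pos).card ≤ S.cap (σ S.shepherd).pos) (v : Fin n) :
    flock S ((algorithm U Λ).round S σ) v = flock S σ v := by
  have key : ∀ r, r ≠ S.shepherd → ((algorithm U Λ).round S σ r).pos = (σ r).pos := by
    intro r hr
    by_cases h' : (σ r).pos = (σ S.shepherd).pos
    · rw [(round_settle hd hID hact hs ht ht' hr h').1, if_pos]
      rw [rank, h']
      refine lt_of_lt_of_le (Finset.card_lt_card (Finset.filter_ssubset.2 ⟨r, ?_, ?_⟩)) hc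
      · exact mem_flock.2 ⟨hr, h'⟩
      · exact lt_irrefl _
    · exact (round_of_ne hr h' hd).1
  ext r
  rw [mem_flock, mem_flock]
  constructor
  · rintro ⟨hr, h⟩
    exact ⟨hr, (key r hr).symm.trans h⟩
  · rintro ⟨hr, h⟩
    exact ⟨hr, (key r hr).trans h⟩

theorem Settling.round (hd : ∀ v, 0 < S.G.deg v) (hinj : Function.Injective S.ID) {b τ : ℕ}
    {σ : Fin k → RobotState n} (hID : CarryIDs S σ) (h : Settling U Λ S b τ σ) (hb : b < Λ n) :
    ∃ τ', Settling U Λ S (b + 1) τ' ((algorithm U Λ).round S σ) := by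
  obtain ⟨hs, hact, hle, hdis⟩ := h
  have hpos : (σ S.shepherd).pos = site U S (Λ n - b) := by
    rw [hs.pos, patrolIndex_add (by omega)]
  have hidx' : patrolIndex (Λ n) (Λ n + b + 1) = Λ n - (b + 1) :=
    patrolIndex_add (b := b + 1) (by omega)
  have hne : site U S (Λ n - (b + 1)) ≠ site U S (Λ n - b) := by
    have := site_succ_ne (U := U) hd (Λ n - (b + 1))
    rw [show Λ n - (b + 1) + 1 = Λ n - b by omega] at this
    exact this.symm
  have hs' := round_shepherd hd hs (by omega) (by omega)
  rw [heard_shepherd_card hact, hpos] at hs'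
  have hact' : ∀ r, r ≠ S.shepherd → ((algorithm U Λ).round S σ r).terminated = false := by
    intro r hr
    by_cases h' : (σ r).pos = (σ S.shepherd).pos
    · exact (round_settle hd hID hact hs (by omega) (by omega) hr h').2
    · exact (round_of_ne hr h' hd).2.trans (hact r hr)
  suffices h : _ ∧ _ from ⟨_, hs', hact', h.1, h.2⟩
  -- If the present node is not overfull, no capacity is exceeded anywhere and nobody moves. The
  -- node becomes the refuge if it has room; otherwise it is full, and either alternative persists.
  by_cases hc : (flock S σ (site U S (Λ n - b))).card ≤ S.cap (site U S (Λ n - b))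
  · have hfl := flock_settle_of_card_le hd hID hact hs (by omega) (by omega) (by rwa [hpos])
    have hall : ∀ v, (flock S σ v).card ≤ S.cap v := by
      intro v
      by_cases hv : v = site U S (Λ n - b)
      · rwa [hv]
      · exact hle v hv
    simp only [hfl]
    refine ⟨fun v _ => hall v, ?_⟩
    by_cases hlt : (flock S σ (site U S (Λ n - b))).card < S.cap (site U S (Λ n - b))
    · left
      rw [updateRefuge, if_pos ⟨by omega, by omega, hlt⟩,
        show 2 * Λ n - (Λ n + b) = Λ n - b by omega]
      exact ⟨hall, by omega, hlt⟩
    · rw [updateRefuge, if_neg (fun h => hlt h.2.2)]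
      rcases hdis with hdis | hdis
      · exact Or.inl hdis
      · right
        intro i hi
        rcases Nat.lt_succ_iff_lt_or_eq.1 hi with hi | rfl
        · exact hdis i hi
        · exact not_lt.1 hlt
  -- An overfull node rules out the first alternative. It keeps exactly its capacity, and the
  -- surplus goes to the next site, the only node where the bound may now fail.
  · have hself := flock_settle_self hd hinj hID hact hs (by omega) (by omega)
      (by rw [hidx', hpos]; exact hne)
    rw [hpos, min_eq_left (not_le.1 hc).le] at hself
    constructor
    · intro v hv
      by_cases hv' : v = site U S (Λ n - b)
      · rw [hv', hself]
      · rw [flock_settle_of_ne hd hID hact hs (by omega) (by omega) (by rwa [hpos])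
          (by rwa [hidx'])]
        exact hle v hv'
    · right
      intro i hi
      by_cases hv : site U S (Λ n - i) = site U S (Λ n - b)
      · rw [hv, hself]
      · refine le_trans ?_ (Finset.card_le_card (flock_subset_settle hd (by rwa [hpos])))
        rcases hdis with hdis | hdis
        · exact absurd (hdis.1 _) hc
        · rcases Nat.lt_succ_iff_lt_or_eq.1 hi with hi | rfl
          · exact hdis i hi
          · exact absurd rfl hv

/-- Leaving out the shepherd creates the gap of one to the total capacity that guarantees it a
place. -/
theorem sum_card_flock (σ : Fin k → RobotState n) :
    ∑ v, (flock S σ v).card = k - 1 := by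
  have h := Finset.card_eq_sum_card_fiberwise (s := Finset.univ.erase S.shepherd)
    (t := (Finset.univ : Finset (Fin n))) (f := fun r => (σ r).pos)
    (fun _ _ => Finset.mem_coe.2 (Finset.mem_univ _))
  rw [Finset.card_erase_of_mem (Finset.mem_univ _), Finset.card_univ, Fintype.card_fin] at h
  rw [h]
  refine Finset.sum_congr rfl fun v _ => congrArg Finset.card (Finset.ext fun r => ?_)
  simp [mem_flock]

/-- After the second way all robots have found room, and the refuge has more of it. -/
theorem run_settle {p q : ℝ} (hS : S.Valid p q) (hd : ∀ v, 0 < S.G.deg v) (hn : n ≠ 1)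
    (hL : 0 < Λ n) (hcover : ∀ v, ∃ t ≤ Λ n, site U S t = v) :
    ∃ τ, ShepherdAt U Λ S (2 * Λ n) τ ((algorithm U Λ).run S (2 * Λ n) S.shepherd) ∧
      (∀ r, r ≠ S.shepherd → ((algorithm U Λ).run S (2 * Λ n) r).terminated = false) ∧
      (∀ v, (flock S ((algorithm U Λ).run S (2 * Λ n)) v).card ≤ S.cap v) ∧
      ∃ τ' ≤ Λ n, (flock S ((algorithm U Λ).run S (2 * Λ n)) (site U S τ')).card <
          S.cap (site U S τ') ∧
        τ' = updateRefuge (Λ n) (2 * Λ n) τ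
          (flock S ((algorithm U Λ).run S (2 * Λ n)) (site U S 0)).card
          (S.cap (site U S 0)) := by
  have key : ∀ b ≤ Λ n, ∃ τ, Settling U Λ S b τ ((algorithm U Λ).run S (Λ n + b)) := by
    intro b hb
    induction b with
    | zero =>
      obtain ⟨hs, hr⟩ := run_gather (U := U) hd hn hL (Λ n) le_rfl
      refine ⟨0, hs, fun r h => (hr r h).1, fun v hv => ?_, Or.inr fun i hi => by omega⟩
      rw [Nat.sub_zero] at hv
      rw [Finset.card_eq_zero.2 (Finset.eq_empty_of_forall_notMem fun r h => ?_)]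
      · exact Nat.zero_le _
      · obtain ⟨hne, hpos⟩ := mem_flock.1 h
        obtain ⟨i, hi, hiv⟩ := hcover v
        exact hv (hpos.symm.trans ((hr r hne).2 i hi (hpos.trans hiv.symm)))
    | succ b ih =>
      obtain ⟨τ, h⟩ := ih (by omega)
      exact h.round hd hS.ID_injective (carryIDs_run _) (by omega)
  obtain ⟨τ, hs, hact, hle, hdis⟩ := key (Λ n) le_rfl
  rw [← two_mul] at hs hact hle hdis
  rw [Nat.sub_self] at hle
  set σ := (algorithm U Λ).run S (2 * Λ n)
  refine ⟨τ, hs, hact, ?_⟩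
  -- The invariant speaks only of nodes already left, so the start is examined separately; its room
  -- enters the refuge in round `2 * Λ n`, when the first dismissals are ordered.
  by_cases hlt : (flock S σ (site U S 0)).card < S.cap (site U S 0)
  · refine ⟨fun v => ?_, 0, Nat.zero_le _, hlt, ?_⟩
    · by_cases hv : v = site U S 0
      · rw [hv]
        exact hlt.le
      · exact hle v hv
    · rw [updateRefuge, if_pos ⟨by omega, le_rfl, hlt⟩, Nat.sub_self]
  · rcases hdis with ⟨h1, h2, h3⟩ | hdis
    · exact ⟨h1, τ, h2, h3, by rw [updateRefuge, if_neg (fun h => hlt h.2.2)]⟩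
    -- Now every node would be full, although `k - 1` robots are too few for that.
    · exfalso
      have hfull : ∀ v, S.cap v ≤ (flock S σ v).card := by
        intro v
        obtain ⟨t, ht, rfl⟩ := hcover v
        rcases Nat.eq_zero_or_pos t with rfl | hpos
        · exact not_lt.1 hlt
        · have := hdis (Λ n - t) (by omega)
          rwa [show Λ n - (Λ n - t) = t by omega] at this
      have h1 := Finset.sum_le_sum fun v (_ : v ∈ Finset.univ) => hfull v
      rw [sum_card_flock] at h1
      have := hS.le_sum_cap
      have := hS.one_lt
      omega

/-! ### Third and fourth way: dismissal and return to the refuge -/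

theorem dispersed {p q : ℝ} (hS : S.Valid p q) (hd : ∀ v, 0 < S.G.deg v) (hn : n ≠ 1)
    (hL : 0 < Λ n) (hcover : ∀ v, ∃ t ≤ Λ n, site U S t = v) :
    ∃ t ≤ 4 * Λ n + 1, (algorithm U Λ).DispersedAt S t := by
  obtain ⟨τ₀, hs₀, hact, hle, τ, hτ, hroom, hupd⟩ := run_settle hS hd hn hL hcover
  have hpos₀ : ((algorithm U Λ).run S (2 * Λ n) S.shepherd).pos = site U S 0 := by
    rw [hs₀.pos]
    exact congrArg _ (patrolIndex_two_mul_add (Nat.zero_le _))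
  set σ := (algorithm U Λ).run S (2 * Λ n) with hσ
  -- Kept apart from the induction because it is needed once more, for the round in which the
  -- shepherd terminates while still giving its order.
  have hrobot : ∀ {i τ' : ℕ}, ShepherdAt U Λ S (2 * Λ n + i) τ'
      ((algorithm U Λ).run S (2 * Λ n + i) S.shepherd) →
      (∀ r, r ≠ S.shepherd → ((algorithm U Λ).run S (2 * Λ n + i) r).pos = (σ r).pos ∧
        ∀ j < i, j ≤ Λ n → (σ r).pos = site U S j →
          ((algorithm U Λ).run S (2 * Λ n + i) r).terminated = true) →
      ∀ r, r ≠ S.shepherd → ((algorithm U Λ).run S (2 * Λ n + (i + 1)) r).pos = (σ r).pos ∧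
        ∀ j < i + 1, j ≤ Λ n → (σ r).pos = site U S j →
          ((algorithm U Λ).run S (2 * Λ n + (i + 1)) r).terminated = true := by
    intro i τ' hs ih r hr
    obtain ⟨h1, h2⟩ := ih r hr
    by_cases h : ((algorithm U Λ).run S (2 * Λ n + i) r).pos =
        ((algorithm U Λ).run S (2 * Λ n + i) S.shepherd).pos
    · obtain ⟨h3, h4⟩ := round_dismiss hs (by omega) hr h
      exact ⟨h3.trans h1, fun _ _ _ _ => h4⟩
    · obtain ⟨h3, h4⟩ := round_of_ne (U := U) (Λ := Λ) hr h hd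
      refine ⟨h3.trans h1, fun j hj hj' hpos => ?_⟩
      rcases Nat.lt_succ_iff_lt_or_eq.1 hj with hj | rfl
      · exact h4.trans (h2 j hj hj' hpos)
      · rw [h1, hs.pos, patrolIndex_two_mul_add hj'] at h
        exact absurd hpos h
  -- The refuge `τ` lies at index `τ` of the walk, reached on the fourth way in round `4 * Λ n - τ`.
  -- Round `2 * Λ n` makes the last update, from `τ₀` to `τ`.
  have key : ∀ i ≤ 2 * Λ n - τ,
      ShepherdAt U Λ S (2 * Λ n + i) (if i = 0 then τ₀ else τ)
        ((algorithm U Λ).run S (2 * Λ n + i) S.shepherd) ∧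
      ∀ r, r ≠ S.shepherd → ((algorithm U Λ).run S (2 * Λ n + i) r).pos = (σ r).pos ∧
        ∀ j < i, j ≤ Λ n → (σ r).pos = site U S j →
          ((algorithm U Λ).run S (2 * Λ n + i) r).terminated = true := by
    intro i hi
    induction i with
    | zero => exact ⟨hs₀, fun r _ => ⟨rfl, fun j hj => by omega⟩⟩
    | succ i ih =>
      obtain ⟨hs, hr⟩ := ih (by omega)
      refine ⟨?_, hrobot hs hr⟩
      rw [if_neg (Nat.succ_ne_zero i)]
      rcases Nat.eq_zero_or_pos i with rfl | hi0
      · have := round_shepherd hd hs₀ (by omega) (by omega)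
        rwa [heard_shepherd_card hact, hpos₀, ← hupd] at this
      · rw [if_neg hi0.ne'] at hs
        have := round_shepherd hd hs (by omega) (by omega)
        rwa [updateRefuge, if_neg (by omega)] at this
  obtain ⟨hs, hr⟩ := key (2 * Λ n - τ) le_rfl
  -- If `τ = Λ n`, the shepherd stops at the end of the third way, and the robots there are
  -- dismissed only in this last round.
  have hr' := hrobot hs hr
  rw [if_neg (by omega)] at hs
  obtain ⟨hterm, hpos⟩ := round_shepherd_terminate hs (by omega)
  rw [hs.pos, show 2 * Λ n + (2 * Λ n - τ) = 4 * Λ n - τ by omega,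
    patrolIndex_four_mul_sub hL hτ] at hpos
  refine ⟨2 * Λ n + (2 * Λ n - τ + 1), by omega, ?_, ?_⟩
  · intro r
    by_cases hrs : r = S.shepherd
    · rw [hrs]
      exact hterm
    · obtain ⟨j, hj, hj'⟩ := hcover (σ r).pos
      exact (hr' r hrs).2 j (by omega) hj hj'.symm
  · intro v
    have hpos' : ((algorithm U Λ).run S (2 * Λ n + (2 * Λ n - τ + 1)) S.shepherd).pos =
        site U S τ := by
      rw [show 2 * Λ n + (2 * Λ n - τ + 1) = 4 * Λ n - τ + 1 by omega]
      exact hpos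
    by_cases hv : v = site U S τ
    · refine le_trans (Finset.card_le_card (t := insert S.shepherd (flock S σ v)) ?_)
        ((Finset.card_insert_le _ _).trans ?_)
      · intro r h
        rw [Finset.mem_insert, mem_flock]
        by_cases hrs : r = S.shepherd
        · exact Or.inl hrs
        · exact Or.inr ⟨hrs, (hr' r hrs).1.symm.trans (Finset.mem_filter.1 h).2⟩
      · rw [hv]
        exact hroom
    · refine le_trans (Finset.card_le_card (t := flock S σ v) ?_) (hle v)
      intro r h
      have h' := (Finset.mem_filter.1 h).2
      rw [mem_flock]
      by_cases hrs : r = S.shepherd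
      · rw [hrs, hpos'] at h'
        exact absurd h'.symm hv
      · exact ⟨hrs, (hr' r hrs).1.symm.trans h'⟩

/-- On a single node everybody terminates at once. -/
theorem dispersed_of_deg_eq_zero (hd : ∀ v, S.G.deg v = 0)
    (hcap : ∀ v, k ≤ S.cap v) : (algorithm U Λ).DispersedAt S 1 := by
  constructor
  · intro r
    have hdeg : ∀ ρ : RobotState n, (view S ρ).deg = 0 := fun ρ => hd _
    simp only [RobotAlgorithm.run, RobotAlgorithm.round, RobotAlgorithm.compute]
    simp only [algorithm, hdeg, if_true]
    split_ifs <;> simp_all [act]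
  · intro v
    refine ((Finset.card_le_univ _).trans ?_).trans (hcap v)
    rw [Fintype.card_fin]

/-! ### Memory -/

theorem run_shepherd_mem_of_deg_eq_zero (hn : n = 1) (hd : ∀ v, S.G.deg v = 0) (t : ℕ) :
    ((algorithm U Λ).run S t S.shepherd).mem = [] := by
  induction t with
  | zero => simp [RobotAlgorithm.run, algorithm, hn]
  | succ t ih =>
    have hdeg : ∀ ρ : RobotState n, (view S ρ).deg = 0 := fun ρ => hd _
    simp only [RobotAlgorithm.run, RobotAlgorithm.round, RobotAlgorithm.compute, if_true]
    split_ifs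
    · exact ih
    · rw [act_mem]
      simp only [algorithm, hdeg, if_true]
      exact ih

theorem run_shepherd_mem (hn : n ≠ 1) (t : ℕ) : ∃ j ≤ 4 * Λ n, ∃ τ ≤ Λ n,
    ((algorithm U Λ).run S t S.shepherd).mem = encode n j τ := by
  induction t with
  | zero => exact ⟨0, Nat.zero_le _, 0, Nat.zero_le _, by simp [RobotAlgorithm.run, algorithm, hn]⟩
  | succ t ih =>
    obtain ⟨j, hj, τ, hτ, hmem⟩ := ih
    simp only [RobotAlgorithm.run, RobotAlgorithm.round, RobotAlgorithm.compute, if_true]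
    split_ifs
    · exact ⟨j, hj, τ, hτ, hmem⟩
    · rw [act_mem, hmem]
      simp only [algorithm, numNodes_encode, clock_encode, refuge_encode]
      split_ifs
      · exact ⟨j, hj, τ, hτ, rfl⟩
      · exact ⟨j, hj, τ, hτ, rfl⟩
      · refine ⟨_, min_le_right _ _, _, ?_, rfl⟩
        unfold updateRefuge
        split_ifs <;> omega

/-- Each of the two nested pairings squares the bound, whence the factor `4`. -/
theorem length_encode_le {N t τ B e : ℕ} (hN : N < B) (ht : t < B) (hτ : τ < B)
    (hB : B ≤ 2 ^ e) : (encode N t τ).length ≤ 4 * e := by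
  rw [encode, Nat.size_eq_bits_len, Nat.size_le]
  have h1 : Nat.pair t τ < B ^ 2 :=
    (Nat.pair_lt_max_add_one_sq t τ).trans_le (Nat.pow_le_pow_left (by omega) 2)
  have h2 : B ≤ B ^ 2 := Nat.le_self_pow two_ne_zero B
  have h3 : Nat.pair N (Nat.pair t τ) < (B ^ 2) ^ 2 :=
    (Nat.pair_lt_max_add_one_sq _ _).trans_le (Nat.pow_le_pow_left (by omega) 2)
  refine h3.trans_le ?_
  rw [← pow_mul, mul_comm 4 e, pow_mul 2 e]
  exact Nat.pow_le_pow_left hB 4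

theorem length_encode_cutoff_le {X M : ℕ → ℕ} {N t τ : ℕ} (hN : 1 ≤ N)
    (ht : t ≤ 4 * ExplorationProcedure.cutoff X M N)
    (hτ : τ ≤ ExplorationProcedure.cutoff X M N) :
    (encode N t τ).length ≤ 4 * (2 * N.size + M N + 5) := by
  have hc : ExplorationProcedure.cutoff X M N ≤ N ^ 2 * 2 ^ (M N + 1) + 1 := min_le_right _ _
  have hK : N ^ 2 ≤ N ^ 2 * 2 ^ (M N + 1) := Nat.le_mul_of_pos_right _ (by positivity)
  have hN2 : N ≤ N ^ 2 := Nat.le_self_pow two_ne_zero N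
  refine length_encode_le (B := 16 * (N ^ 2 * 2 ^ (M N + 1))) (by omega) (by omega) (by omega) ?_
  have hs : N ^ 2 ≤ (2 ^ N.size) ^ 2 := Nat.pow_le_pow_left (Nat.size_le.1 le_rfl).le 2
  calc 16 * (N ^ 2 * 2 ^ (M N + 1)) ≤ 16 * ((2 ^ N.size) ^ 2 * 2 ^ (M N + 1)) := by gcongr
    _ = 2 ^ (2 * N.size + M N + 5) := by ring

end Correctness

end Herding

/-! ### Real logarithms and the final bounds -/

theorem Nat.size_le_logb_add_one {a : ℕ} (ha : 1 ≤ a) : (a.size : ℝ) ≤ Real.logb 2 a + 1 := by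
  have hpos : 0 < a.size := Nat.size_pos.2 ha
  have h : 2 ^ (a.size - 1) ≤ a := Nat.lt_size.1 (by omega)
  have h' : ((a.size - 1 : ℕ) : ℝ) ≤ Real.logb 2 a := by
    rw [Real.le_logb_iff_rpow_le one_lt_two (by exact_mod_cast ha), Real.rpow_natCast]
    exact_mod_cast h
  rw [Nat.cast_sub hpos] at h'
  push_cast at h'
  linarith

/-- Allows the `log n` bits of the clock to be absorbed into `m * log (n * k)`. -/
theorem PortGraph.one_le_numEdges {n : ℕ} (G : PortGraph n) (hG : G.graph.Connected)
    (hn : 2 ≤ n) : 1 ≤ G.numEdges := by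
  have h := hG.card_vert_le_card_edgeSet_add_one
  rw [Nat.card_fin, Nat.card_coe_set_eq] at h
  unfold PortGraph.numEdges
  omega

theorem PortGraph.deg_eq_zero (G : PortGraph 1) (v : Fin 1) : G.deg v = 0 := by
  have : IsEmpty (G.graph.neighborSet v) := ⟨fun u => u.2.ne (Subsingleton.elim _ _)⟩
  exact Nat.card_of_isEmpty

theorem theorem5 :
    ∃ C : ℝ → ℝ → ℝ,
      ∀ (𝒢 : ∀ n : ℕ, PortGraph n → Prop) (U : ExplorationProcedure) (X M : ℕ → ℕ),
        U.IsUXS 𝒢 X → U.UsesMemory X M →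
        ∃ A : RobotAlgorithm,
          ∀ p q : ℝ, 0 < p → 0 < q →
          ∀ (n k : ℕ) (S : Scenario n k), 𝒢 n S.G → S.Valid p q →
            (∃ t : ℕ, (t : ℝ) ≤ C p q * ((X n : ℝ) + (n : ℝ) ^ 3 + (S.G.numEdges : ℝ)) ∧
              A.DispersedAt S t) ∧
            (∀ t : ℕ, (A.memBits S S.shepherd t : ℝ) ≤
              C p q * ((M n : ℝ) + (S.G.numEdges : ℝ) * Real.logb 2 ((n : ℝ) * (k : ℝ)))) ∧
            (∀ r : Fin k, r ≠ S.shepherd → ∀ t : ℕ,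
              (A.memBits S r t : ℝ) ≤ C p q * Real.logb 2 (k : ℝ)) := by
  -- The shepherd needs at most `8 * log n + 4 * M n + 28` bits when `n ≥ 2`, and `28 ≤ 14 * (log n
  -- + log k)`, whence `22 = 8 + 14`. The IDs contribute `q`.
  refine ⟨fun _ q => 22 + q, fun 𝒢 U X M hU hM =>
    ⟨Herding.algorithm U (ExplorationProcedure.cutoff X M), fun p q _ hq n k S hG hS => ?_⟩⟩
  have hk : (2 : ℝ) ≤ k := by exact_mod_cast hS.one_lt
  have hlogk : 1 ≤ Real.logb 2 k := by
    rw [Real.le_logb_iff_rpow_le one_lt_two (by linarith), Real.rpow_one]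
    exact hk
  have hn1 : 1 ≤ n := Nat.one_le_iff_ne_zero.2 (by rintro rfl; exact (S.start S.shepherd).elim0)
  have hn1' : (1 : ℝ) ≤ n := by exact_mod_cast hn1
  have hn3 : (1 : ℝ) ≤ (n : ℝ) ^ 3 := one_le_pow₀ hn1'
  have hX : (0 : ℝ) ≤ X n := Nat.cast_nonneg _
  have hm : (0 : ℝ) ≤ S.G.numEdges := Nat.cast_nonneg _
  have hM0 : (0 : ℝ) ≤ M n := Nat.cast_nonneg _
  have htime : ∀ t : ℕ, t ≤ 4 * X n + 1 →
      (t : ℝ) ≤ (22 + q) * ((X n : ℝ) + (n : ℝ) ^ 3 + (S.G.numEdges : ℝ)) := by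
    intro t ht
    have ht' : (t : ℝ) ≤ 4 * X n + 1 := by exact_mod_cast ht
    have := mul_nonneg hq.le (show 0 ≤ (X n : ℝ) + (n : ℝ) ^ 3 + (S.G.numEdges : ℝ) by linarith)
    linarith
  refine ⟨?_, ?_, ?_⟩
  · by_cases hn : n = 1
    · subst hn
      refine ⟨1, htime 1 (by omega), Herding.dispersed_of_deg_eq_zero S.G.deg_eq_zero fun v => ?_⟩
      have h := hS.le_sum_cap
      rwa [Fintype.sum_subsingleton _ v] at h
    · have hd := S.G.deg_pos hS.connected (by omega)
      have hcover := U.exists_le_cutoff hU hM S.G hG hS.connected hd (S.start S.shepherd)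
      -- A walk of length `0` would miss every node other than the start.
      have hL : 0 < ExplorationProcedure.cutoff X M n := by
        by_contra! h0
        have : Nontrivial (Fin n) := Fin.nontrivial_iff_two_le.2 (by omega)
        obtain ⟨v, hv⟩ := exists_ne (S.start S.shepherd)
        obtain ⟨t, ht, htv⟩ := hcover v
        rw [Nat.le_zero.1 (ht.trans h0)] at htv
        exact hv htv.symm
      obtain ⟨t, ht, hdisp⟩ := Herding.dispersed hS hd hn hL hcover
      have hcX : ExplorationProcedure.cutoff X M n ≤ X n := min_le_left _ _
      exact ⟨t, htime t (by omega), hdisp⟩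
  · intro t
    rw [RobotAlgorithm.memBits]
    by_cases hn : n = 1
    · subst hn
      rw [Herding.run_shepherd_mem_of_deg_eq_zero rfl S.G.deg_eq_zero]
      have : 0 ≤ Real.logb 2 (((1 : ℕ) : ℝ) * (k : ℝ)) := by
        rw [Nat.cast_one, one_mul]
        linarith
      rw [List.length_nil, Nat.cast_zero]
      positivity
    · obtain ⟨j, hj, τ, hτ, hmem⟩ := Herding.run_shepherd_mem
        (U := U) (Λ := ExplorationProcedure.cutoff X M) (S := S) hn t
      rw [hmem]
      have h1 : ((Herding.encode n j τ).length : ℝ) ≤ 4 * (2 * n.size + M n + 5) := by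
        exact_mod_cast Herding.length_encode_cutoff_le hn1 hj hτ
      have h2 := Nat.size_le_logb_add_one hn1
      have hlogn : 1 ≤ Real.logb 2 n := by
        rw [Real.le_logb_iff_rpow_le one_lt_two (by linarith), Real.rpow_one]
        exact_mod_cast (show 2 ≤ n by omega)
      have hlog : Real.logb 2 ((n : ℝ) * k) = Real.logb 2 n + Real.logb 2 k :=
        Real.logb_mul (by linarith) (by linarith)
      have hm1 : (1 : ℝ) ≤ S.G.numEdges := by
        exact_mod_cast S.G.one_le_numEdges hS.connected (by omega)
      have h3 : Real.logb 2 ((n : ℝ) * k) ≤ S.G.numEdges * Real.logb 2 ((n : ℝ) * k) :=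
        le_mul_of_one_le_left (by linarith) hm1
      have h4 := mul_nonneg hq.le (show 0 ≤ (M n : ℝ) +
        S.G.numEdges * Real.logb 2 ((n : ℝ) * k) by linarith)
      linarith
  · intro r hr t
    rw [RobotAlgorithm.memBits, Herding.run_mem t hr, Nat.size_eq_bits_len]
    have h1 := Nat.size_le_logb_add_one (hS.one_le_ID r)
    have h2 : Real.logb 2 (S.ID r) ≤ q * Real.logb 2 k := by
      rw [← Real.logb_rpow_eq_mul_logb_of_pos (by linarith)]
      exact Real.logb_le_logb_of_le one_lt_two (by exact_mod_cast hS.one_le_ID r) (hS.ID_le r)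
    linarith
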